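/- Let $X$ be a finite set of inputs, let $P(c,x)$ be a probability distribution on $\{0,1\}\times X$ with marginal $P(x)=\sum_c P(c,x)$, and let $x\mapsto\rho(x)$ be a fixed map from $X$ to density matrices on a finite-dimensional complex Hilbert space $Q$. For a two-outcome POVM $\Pi=\{\Pi_0,\Pi_1\}$ on $Q$ (positive semidefinite operators with $\Pi_0+\Pi_1=1$) let $\ell_\Pi(c,x)=\sum_{\tilde c\ne c}\mathrm{Tr}[\Pi_{\tilde c}\,\rho(x)]$ be the linear loss, $R(\Pi)=\sum_{c,x}P(c,x)\,\ell_\Pi(c,x)$ the true risk, and, for a training set $\mathcal T=\{(c_k,x_k)\}_{k=1}^T$, $R^{\mathcal T}(\Pi)=\frac1T\sum_{k=1}^T\ell_\Pi(c_k,x_k)$ the empirical risk. Put $$\mathcal B=\Big(\mathrm{Tr}\sqrt{\textstyle\sum_x P(x)\,\rho(x)^2}\Big)^2 .$$ Then the minimum of $R$ over all POVMs is attained and, for every $T\ge 1$ and every training set $\mathcal T$ of size $T$, so is the minimum of $R^{\mathcal T}$. For every $T\ge1$ and $\delta>0$, if the $T$ elements of $\mathcal T$ are drawn independently from $P$, then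 with probability at least $1-\delta$ every minimizer $\Pi^{\mathcal T}$ of $R^{\mathcal T}$ satisfies $$R(\Pi^{\mathcal T})-\min_\Pi R(\Pi)\;\le\;2\sqrt{\frac{\mathcal B}{T}}+\sqrt{\frac{2\log(1/\delta)}{T}}$$ (natural logarithm; for $\delta\ge1$ the claim is void). Moreover $$\mathcal B=2^{I_2(X:Q)},$$ where $I_2(X{:}Q)$ is the 2-Rényi mutual information of the marginal on $XQ$ of the classical-quantum state $\rho_{CXQ}=\sum_{c,x}P(c,x)\,|c\rangle\langle c|\otimes|x\rangle\langle x|\otimes\rho(x)$. Here, for a state $\rho_{AB}$ and $\alpha\ne1$, $$I_\alpha(A{:}B)=\frac{\alpha}{\alpha-1}\log_2\mathrm{Tr}\Big(\mathrm{Tr}_A\big[\rho_A^{\frac{1-\alpha}2}\rho_{AB}^{\alpha}\rho_A^{\frac{1-\alpha}2}\big]\Big)^{1/\alpha},$$ with negative powers taken on the support. -/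

import Mathlib

open MeasureTheory
open scoped Kronecker MatrixOrder ComplexOrder

noncomputable section

namespace QML

variable {A B C X Q : Type*}

/-- Density matrices on the finite-dimensional Hilbert space with orthonormal basis `Q`:
positive semidefinite matrices with unit trace. -/
structure DensityMatrix (Q : Type*) [Fintype Q] where
  /-- the underlying matrix -/
  mat : Matrix Q Q ℂ
  posSemidef : mat.PosSemidef
  trace_eq_one : mat.trace = 1

/-- Positive operator-valued measures with outcomes in `C` on the Hilbert space with basis `Q`. -/
structure POVM (C Q : Type*) [Fintype C] [Fintype Q] [DecidableEq Q] where
  /-- the operator attached to each outcome -/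
  op : C → Matrix Q Q ℂ
  posSemidef : ∀ c, (op c).PosSemidef
  sum_eq_one : ∑ c, op c = 1

section Learning

variable [Fintype C] [DecidableEq C] [Fintype X] [Fintype Q] [DecidableEq Q]

/-- Linear loss: the probability that measuring `ρ(x)` with `M` gives an outcome other than `c`. -/
def loss (ρ : X → DensityMatrix Q) (M : POVM C Q) (z : C × X) : ℝ :=
  ∑ c' ∈ Finset.univ.erase z.1, (M.op c' * (ρ z.2).mat).trace.re

/-- Empirical risk: the average loss over the training set `S` of size `T`. -/
def empRisk {T : ℕ} (ρ : X → DensityMatrix Q) (S : Fin T → C × X) (M : POVM C Q) : ℝ :=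
  (1 / (T : ℝ)) * ∑ k, loss ρ M (S k)

/-- True risk: the expected loss under the distribution `P` of pairs `(c, x)`. -/
def risk (P : PMF (C × X)) (ρ : X → DensityMatrix Q) (M : POVM C Q) : ℝ :=
  ∑ z, (P z).toReal * loss ρ M z

/-- `M` minimizes the empirical risk on the training set `S` among all POVMs. -/
def IsERM {T : ℕ} (ρ : X → DensityMatrix Q) (S : Fin T → C × X) (M : POVM C Q) : Prop :=
  ∀ M' : POVM C Q, empRisk ρ S M ≤ empRisk ρ S M'

/-- `M` minimizes the true risk among all POVMs. -/
def IsOptimal (P : PMF (C × X)) (ρ : X → DensityMatrix Q) (M : POVM C Q) : Prop :=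
  ∀ M' : POVM C Q, risk P ρ M ≤ risk P ρ M'

/-- Generalization (estimation) error of `M`: its true risk minus the least true risk of a POVM. -/
def genError (P : PMF (C × X)) (ρ : X → DensityMatrix Q) (M : POVM C Q) : ℝ :=
  risk P ρ M - ⨅ M' : POVM C Q, risk P ρ M'

/-- The marginal probability `P(x) = ∑_c P(c, x)`. -/
def marginal (P : PMF (C × X)) (x : X) : ℝ := ∑ c, (P (c, x)).toReal

/-- The generalization bound `(Tr √(∑_x P(x) ρ(x)²))²`. -/
def genBound (P : PMF (C × X)) (ρ : X → DensityMatrix Q) : ℝ :=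
  ((CFC.sqrt (∑ x, (marginal P x : ℂ) • (ρ x).mat ^ 2)).trace.re) ^ 2

/-- The classical-quantum state `ρ_CXQ = ∑_{c,x} P(c, x) |c⟩⟨c| ⊗ |x⟩⟨x| ⊗ ρ(x)`. -/
def cqState [DecidableEq X] (P : PMF (C × X)) (ρ : X → DensityMatrix Q) :
    Matrix (C × X × Q) (C × X × Q) ℂ :=
  ∑ c, ∑ x, (((P (c, x)).toReal : ℝ) : ℂ) •
    (Matrix.single c c (1 : ℂ) ⊗ₖ (Matrix.single x x (1 : ℂ) ⊗ₖ (ρ x).mat))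

end Learning

section Information

/-- The partial trace over the first tensor factor. -/
def traceFst [Fintype A] (M : Matrix (A × B) (A × B) ℂ) : Matrix B B ℂ :=
  Matrix.of fun i j => ∑ a, M (a, i) (a, j)

/-- The partial trace over the second tensor factor. -/
def traceSnd [Fintype B] (M : Matrix (A × B) (A × B) ℂ) : Matrix A A ℂ :=
  Matrix.of fun i j => ∑ b, M (i, b) (j, b)

/-- The `α`-Rényi mutual information `I_α(A:B)` of a state `M` on `A ⊗ B`, that is,
`α / (α - 1) * log₂ Tr (Tr_A (ρ_A^((1-α)/2) ρ_AB^α ρ_A^((1-α)/2)))^(1/α)`. Real powers are taken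
through the functional calculus, so that negative powers are inverses on the support. -/
def renyiMutualInfo [Fintype A] [DecidableEq A] [Fintype B] [DecidableEq B]
    (α : ℝ) (M : Matrix (A × B) (A × B) ℂ) : ℝ :=
  let K : Matrix (A × B) (A × B) ℂ := (traceSnd M ^ ((1 - α) / 2)) ⊗ₖ (1 : Matrix B B ℂ)
  α / (α - 1) * Real.logb 2 ((traceFst (K * M ^ α * K)) ^ (1 / α)).trace.re

end Information

end QML

end

/-! A binary measurement is determined by its effect `E = Π₁`, and up to a constant its loss at
`z = (c, x)` is `Tr (E Y(z))` with `Y(z) = ± ρ(x)`, the sign depending on `c` (`signedState`). Hence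
every weighted sum of losses is an affine function of `E`. It is minimized by the spectral projection
onto the negative part of the corresponding sum of the `Y(z)`, which gives the optimal measurement
and the empirical risk minimizers.

Let `M₀` be optimal. The excess risk of an empirical minimizer is at most the supremum over all
measurements `M` of the deviation of the mean of `ℓ_M - ℓ_M₀` from its empirical mean. As
`ℓ_M - ℓ_M₀` takes values in `[-1, 1]`, replacing one sample changes this supremum by at most `2 / T`,
and McDiarmid's inequality bounds it by its expectation plus `√(2 log (1 / δ) / T)`.

The expectation is bounded without symmetrization. The deviation equals `Tr ((E - E₀) D)`, where `D`
is the deviation of the mean of `Y` from its empirical mean (`signedDeviation`). Since `D` is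
centred, only `Tr (E D)` matters. For every positive definite `N`, a weighted Cauchy–Schwarz
inequality (`two_mul_trace_mul_le`) gives `2 Tr (E D) ≤ Tr N + Tr (N⁻¹ D²)`, uniformly in `E`. The
expectation of `D²` is the matrix-valued variance of an empirical mean, at most `T⁻¹ ∑ P(x) ρ(x)²`,
so the choice of `N` as the root of this matrix, shifted by a multiple of `1` to be invertible, bounds
the expected supremum by `√(B / T)` plus the cost of the shift, which is made equal to `√(B / T)`.

For the Rényi mutual information, all operators involved are diagonal in the register `X`, and the
block of `x` is `P(x)^(-1/2) (P(x) ρ(x))² P(x)^(-1/2) = P(x) ρ(x)²`. -/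

namespace QML

/-! ### Expectations over independent samples from a finite set -/

/-- The expectation of `F` over `T` independent samples from the finite set `Z`, each drawn with
weights `w`. It is linear in `F`, whose values may lie in any real vector space. -/
noncomputable def sampleExp {Z E : Type*} [Fintype Z] [AddCommGroup E] [Module ℝ E] {T : ℕ}
    (w : Z → ℝ) (F : (Fin T → Z) → E) : E :=
  ∑ S, (∏ k, w (S k)) • F S

section SampleExp

variable {Z E : Type*} [Fintype Z] [AddCommGroup E] [Module ℝ E] {T : ℕ} {w : Z → ℝ}

lemma sampleExp_zero (F : (Fin 0 → Z) → E) : sampleExp w F = F Fin.elim0 := by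
  rw [sampleExp, Fintype.sum_unique]
  simp only [Finset.univ_eq_empty, Finset.prod_empty, one_smul]
  congr 1

lemma sampleExp_succ (F : (Fin (T + 1) → Z) → E) :
    sampleExp w F = ∑ z, w z • sampleExp w fun S : Fin T → Z => F (Fin.cons z S) := by
  simp only [sampleExp, Finset.smul_sum, smul_smul]
  rw [← (Fin.consEquiv fun _ => Z).sum_comp, Fintype.sum_prod_type]
  simp [Fin.consEquiv, Fin.prod_univ_succ]

lemma sampleExp_add (F G : (Fin T → Z) → E) :
    sampleExp w (fun S => F S + G S) = sampleExp w F + sampleExp w G := by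
  simp [sampleExp, Finset.sum_add_distrib]

lemma sampleExp_map {E' : Type*} [AddCommGroup E'] [Module ℝ E'] (φ : E →ₗ[ℝ] E')
    (F : (Fin T → Z) → E) : sampleExp w (fun S => φ (F S)) = φ (sampleExp w F) := by
  simp [sampleExp, map_sum]

lemma sampleExp_const (hw : ∑ z, w z = 1) (e : E) :
    sampleExp w (fun _ : Fin T → Z => e) = e := by
  rw [sampleExp, ← Finset.sum_smul, ← Fintype.prod_sum fun _ : Fin T => w]
  simp [hw]

lemma sampleExp_mono (hw : ∀ z, 0 ≤ w z) {F G : (Fin T → Z) → ℝ} (h : ∀ S, F S ≤ G S) :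
    sampleExp w F ≤ sampleExp w G :=
  Finset.sum_le_sum fun S _ =>
    smul_le_smul_of_nonneg_left (h S) (Finset.prod_nonneg fun k _ => hw (S k))

/-- A sum over the sample of a centred function is centred. -/
lemma sampleExp_sum_of_centered (hw : ∑ z, w z = 1) {v : Z → E} (hv : ∑ z, w z • v z = 0) :
    sampleExp w (fun S : Fin T → Z => ∑ k, v (S k)) = 0 := by
  induction T with
  | zero => simp [sampleExp_zero]
  | succ T ih => simp [sampleExp_succ, Fin.sum_univ_succ, sampleExp_add, sampleExp_const hw, ih, hv]

/-- The second moments of independent centred variables add up, also for non-commuting values. -/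
lemma sampleExp_sum_mul_sum_of_centered {R : Type*} [Ring R] [Algebra ℝ R]
    (hw : ∑ z, w z = 1) {v : Z → R} (hv : ∑ z, w z • v z = 0) :
    sampleExp w (fun S : Fin T → Z => (∑ k, v (S k)) * ∑ k, v (S k))
      = (T : ℝ) • ∑ z, w z • (v z * v z) := by
  induction T with
  | zero => simp [sampleExp_zero]
  | succ T ih =>
    have key : ∀ z, sampleExp w (fun S : Fin T → Z => (v z + ∑ k, v (S k)) * (v z + ∑ k, v (S k)))
        = v z * v z + (T : ℝ) • ∑ z, w z • (v z * v z) := by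
      intro z
      have h1 := sampleExp_map (w := w) (LinearMap.mulLeft ℝ (v z))
        (fun S : Fin T → Z => ∑ k, v (S k))
      have h2 := sampleExp_map (w := w) (LinearMap.mulRight ℝ (v z))
        (fun S : Fin T → Z => ∑ k, v (S k))
      simp only [LinearMap.mulLeft_apply, LinearMap.mulRight_apply,
        sampleExp_sum_of_centered hw hv, mul_zero, zero_mul] at h1 h2
      simp only [add_mul, mul_add, sampleExp_add, sampleExp_const hw, h1, h2, ih]
      abel
    rw [sampleExp_succ]
    simp only [Fin.sum_univ_succ, Fin.cons_zero, Fin.cons_succ, key, smul_add,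
      Finset.sum_add_distrib, ← Finset.sum_smul, hw, one_smul]
    push_cast
    rw [add_smul, one_smul, add_comm]

end SampleExp

/-! ### The bounded differences inequality -/

section BoundedDifferences

variable {Z : Type*} [Fintype Z] {T : ℕ} (p : PMF Z)

lemma sum_toReal_pmf : ∑ z, (p z).toReal = 1 := by
  rw [← ENNReal.toReal_sum fun z _ => p.apply_ne_top z, ← tsum_fintype (L := .unconditional _),
    p.tsum_coe, ENNReal.toReal_one]

/-- Hoeffding's lemma on a finite set, for a function of oscillation at most `c`. -/
lemma sum_mul_exp_sub_mean_le {g : Z → ℝ} {c : ℝ} (h : ∀ z z', g z - g z' ≤ c) :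
    ∑ z, (p z).toReal * Real.exp (g z - ∑ z, (p z).toReal * g z) ≤ Real.exp (c ^ 2 / 8) := by
  let _ : MeasurableSpace Z := ⊤
  have : MeasurableSingletonClass Z := ⟨fun _ => trivial⟩
  obtain ⟨z₀, -⟩ := p.support_nonempty
  obtain ⟨a, ha⟩ := @Finite.exists_min Z ℝ _ ⟨z₀⟩ _ g
  have hH := (ProbabilityTheory.hasSubgaussianMGF_of_mem_Icc (μ := p.toMeasure) (X := g)
    (a := g a) (b := g a + c) (measurable_of_finite g).aemeasurable
    (Filter.Eventually.of_forall fun z => ⟨ha z, by linarith [h z a]⟩)).mgf_le 1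
  rw [ProbabilityTheory.mgf, PMF.integral_eq_sum, PMF.integral_eq_sum] at hH
  simp only [one_mul, smul_eq_mul] at hH
  refine hH.trans (le_of_eq ?_)
  congr 1
  push_cast
  rw [add_sub_cancel_left, Real.norm_eq_abs, div_pow, sq_abs]
  ring

/-- The exponential moment form of McDiarmid's inequality: replacing one sample changes `f` by at
most `c`. The proof conditions on the first sample and applies Hoeffding's lemma to the conditional
mean, which inherits the bound `c` on its oscillation. -/
lemma sampleExp_exp_sub_mean_le {c : ℝ} {f : (Fin T → Z) → ℝ}
    (h : ∀ S k z, f S - f (Function.update S k z) ≤ c) :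
    sampleExp (fun z => (p z).toReal)
      (fun S => Real.exp (f S - sampleExp (fun z => (p z).toReal) f))
        ≤ Real.exp (T * (c ^ 2 / 8)) := by
  set w : Z → ℝ := fun z => (p z).toReal with hw
  have hw0 : ∀ z, 0 ≤ w z := fun z => ENNReal.toReal_nonneg
  have hw1 : ∑ z, w z = 1 := sum_toReal_pmf p
  induction T with
  | zero => simp [sampleExp_zero]
  | succ T ih =>
    set g : Z → ℝ := fun z => sampleExp w fun S : Fin T → Z => f (Fin.cons z S) with hg
    have hgf : sampleExp w f = ∑ z, w z * g z := by
      rw [sampleExp_succ]; simp [hg]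
    have hosc : ∀ z z', g z - g z' ≤ c := by
      intro z z'
      have : g z ≤ sampleExp w fun S : Fin T → Z => f (Fin.cons z' S) + c := by
        refine sampleExp_mono hw0 fun S => ?_
        have := h (Fin.cons z S) 0 z'
        rw [Fin.update_cons_zero] at this
        linarith
      rw [sampleExp_add, sampleExp_const hw1] at this
      linarith
    have hstep : ∀ z, sampleExp w
        (fun S : Fin T → Z => Real.exp (f (Fin.cons z S) - sampleExp w f))
          ≤ Real.exp (g z - ∑ z, w z * g z) * Real.exp (T * (c ^ 2 / 8)) := by
      intro z
      have h1 : ∀ S : Fin T → Z, Real.exp (f (Fin.cons z S) - sampleExp w f)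
          = (LinearMap.mulLeft ℝ (Real.exp (g z - ∑ z, w z * g z)))
              (Real.exp (f (Fin.cons z S) - g z)) := by
        intro S
        rw [LinearMap.mulLeft_apply, ← Real.exp_add, hgf]
        congr 1; ring
      simp only [h1]
      rw [sampleExp_map, LinearMap.mulLeft_apply]
      refine mul_le_mul_of_nonneg_left (ih fun S k z' => ?_) (Real.exp_nonneg _)
      rw [Fin.cons_update]
      exact h _ _ _
    rw [sampleExp_succ]
    calc ∑ z, w z • sampleExp w
          (fun S : Fin T → Z => Real.exp (f (Fin.cons z S) - sampleExp w f))
        ≤ ∑ z, w z * (Real.exp (g z - ∑ z, w z * g z) * Real.exp (T * (c ^ 2 / 8))) :=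
          Finset.sum_le_sum fun z _ => mul_le_mul_of_nonneg_left (hstep z) (hw0 z)
      _ = (∑ z, w z * Real.exp (g z - ∑ z, w z * g z)) * Real.exp (T * (c ^ 2 / 8)) := by
          rw [Finset.sum_mul]; exact Finset.sum_congr rfl fun z _ => by ring
      _ ≤ Real.exp (c ^ 2 / 8) * Real.exp (T * (c ^ 2 / 8)) :=
          mul_le_mul_of_nonneg_right (sum_mul_exp_sub_mean_le p hosc) (Real.exp_nonneg _)
      _ = Real.exp ((T + 1 : ℕ) * (c ^ 2 / 8)) := by
          rw [← Real.exp_add]; congr 1; push_cast; ring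

lemma measureReal_pi_eq_sampleExp [MeasurableSpace Z] [MeasurableSingletonClass Z]
    (A : Set (Fin T → Z)) :
    (Measure.pi fun _ : Fin T => p.toMeasure).real A
      = sampleExp (fun z => (p z).toReal) (A.indicator fun _ => (1 : ℝ)) := by
  classical
  rw [← Set.coe_toFinset A, ← sum_measureReal_singleton, sampleExp]
  simp only [smul_eq_mul, Set.indicator_apply, mul_ite, mul_one, mul_zero, Finset.mem_coe]
  rw [← Finset.sum_filter, Finset.filter_mem_eq_inter, Finset.univ_inter]
  refine Finset.sum_congr rfl fun S _ => ?_
  simp [measureReal_def, Measure.pi_singleton,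
    PMF.toMeasure_apply_singleton _ _ (measurableSet_singleton _), ENNReal.toReal_prod]

/-- **McDiarmid's inequality** on a finite set, with sharp constant, at confidence `1 - δ`. -/
lemma one_sub_le_measureReal_pi_of_bounded_differences [MeasurableSpace Z]
    [MeasurableSingletonClass Z] (hT : 1 ≤ T) {f : (Fin T → Z) → ℝ}
    (h : ∀ S k z, f S - f (Function.update S k z) ≤ 2 / T) {δ : ℝ} (hδ : 0 < δ) :
    1 - δ ≤ (Measure.pi fun _ : Fin T => p.toMeasure).real
      {S | f S ≤ sampleExp (fun z => (p z).toReal) f + √(2 * Real.log (1 / δ) / T)} := by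
  rcases le_or_gt 1 δ with h1 | h1
  · exact (sub_nonpos.2 h1).trans measureReal_nonneg
  set w : Z → ℝ := fun z => (p z).toReal
  have hw0 : ∀ z, 0 ≤ w z := fun z => ENNReal.toReal_nonneg
  have hw1 : ∑ z, w z = 1 := sum_toReal_pmf p
  have hT0 : (0 : ℝ) < T := by exact_mod_cast hT
  have hlog : 0 < Real.log (1 / δ) := Real.log_pos (by rw [lt_div_iff₀ hδ]; linarith)
  set ε := √(2 * Real.log (1 / δ) / T) with hε
  have hε2 : ε ^ 2 = 2 * Real.log (1 / δ) / T := Real.sq_sqrt (by positivity)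
  have hε0 : 0 ≤ ε := Real.sqrt_nonneg _
  set m := sampleExp w f
  -- Chernoff's bound with the optimal exponent `l = T * ε`.
  set l : ℝ := T * ε with hl
  have hl0 : 0 ≤ l := by positivity
  have hm : sampleExp w (fun S => l * f S) = l * m := sampleExp_map (LinearMap.mulLeft ℝ l) f
  have hmgf := sampleExp_exp_sub_mean_le (T := T) p (c := l * (2 / T)) (f := fun S => l * f S)
    (fun S k z => by
      rw [← mul_sub]; exact mul_le_mul_of_nonneg_left (h S k z) hl0)
  rw [show sampleExp (fun z => (p z).toReal) (fun S => l * f S) = l * m from hm] at hmgf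
  have hexp : Real.exp (T * ((l * (2 / T)) ^ 2 / 8)) * Real.exp (-(l * ε)) = δ := by
    rw [← Real.exp_add]
    have : T * ((l * (2 / T)) ^ 2 / 8) + -(l * ε) = -(T * ε ^ 2 / 2) := by
      rw [hl]; field_simp; ring
    rw [this, hε2, show -(T * (2 * Real.log (1 / δ) / T) / 2) = -Real.log (1 / δ) by field_simp,
      one_div, Real.log_inv, neg_neg, Real.exp_log hδ]
  rw [measureReal_pi_eq_sampleExp]
  have hpt : ∀ S, 1 ≤ ({S | f S ≤ m + ε} : Set (Fin T → Z)).indicator (fun _ => (1 : ℝ)) S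
      + LinearMap.mulRight ℝ (Real.exp (-(l * ε))) (Real.exp (l * f S - l * m)) := by
    intro S
    rw [LinearMap.mulRight_apply, ← Real.exp_add]
    by_cases hS : f S ≤ m + ε
    · rw [Set.indicator_of_mem (by exact hS)]
      linarith [Real.exp_nonneg (l * f S - l * m + -(l * ε))]
    · rw [Set.indicator_of_notMem (by exact hS), zero_add]
      refine Real.one_le_exp ?_
      have := mul_nonneg hl0 (show 0 ≤ f S - m - ε by linarith [not_le.1 hS])
      linarith
  have hint := sampleExp_mono hw0 hpt
  rw [sampleExp_const hw1, sampleExp_add, sampleExp_map, LinearMap.mulRight_apply] at hint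
  have := mul_le_mul_of_nonneg_right hmgf (Real.exp_nonneg (-(l * ε)))
  rw [hexp] at this
  linarith

end BoundedDifferences

/-! ### Uniform deviations over a class of bounded functions -/

section UniformDeviation

variable {Z : Type*} [Fintype Z] {T : ℕ} (p : PMF Z)

/-- If the deviations between true and empirical means of a class of functions with values in
`[-1, 1]` are dominated by a random variable of expectation at most `m`, then with probability at
least `1 - δ` they are all at most `m + √(2 log (1 / δ) / T)`: the supremum of the deviations
changes by at most `2 / T` when one sample is replaced. -/
lemma one_sub_le_measureReal_pi_deviation_le [MeasurableSpace Z]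
    [MeasurableSingletonClass Z] (hT : 1 ≤ T) {ι : Type*} [Nonempty ι] {g : ι → Z → ℝ}
    (hg : ∀ i z, |g i z| ≤ 1) {q : (Fin T → Z) → ℝ} {m : ℝ}
    (hq : ∀ i S, ∑ z, (p z).toReal * g i z - 1 / (T : ℝ) * ∑ k, g i (S k) ≤ q S)
    (hm : sampleExp (fun z => (p z).toReal) q ≤ m) {δ : ℝ} (hδ : 0 < δ) :
    1 - δ ≤ (Measure.pi fun _ : Fin T => p.toMeasure).real
      {S | ∀ i, ∑ z, (p z).toReal * g i z - 1 / (T : ℝ) * ∑ k, g i (S k)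
        ≤ m + √(2 * Real.log (1 / δ) / T)} := by
  classical
  have hT0 : (0 : ℝ) < T := by exact_mod_cast hT
  set gap : ι → (Fin T → Z) → ℝ :=
    fun i S => ∑ z, (p z).toReal * g i z - 1 / (T : ℝ) * ∑ k, g i (S k) with hgap
  have hbdd : ∀ S, BddAbove (Set.range fun i => gap i S) :=
    fun S => ⟨q S, by rintro _ ⟨i, rfl⟩; exact hq i S⟩
  have hdiff : ∀ S k z, (⨆ i, gap i S) - (⨆ i, gap i (Function.update S k z)) ≤ 2 / T := by
    intro S k z
    rw [sub_le_iff_le_add]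
    refine ciSup_le fun i => ?_
    have h1 := le_ciSup (hbdd (Function.update S k z)) i
    have h2 : ∑ j, g i (Function.update S k z j) = ∑ j, g i (S j) + (g i z - g i (S k)) := by
      rw [← Finset.add_sum_erase _ _ (Finset.mem_univ k),
        ← Finset.add_sum_erase _ (fun j => g i (S j)) (Finset.mem_univ k), Function.update_self,
        Finset.sum_congr rfl fun j hj => by
          rw [Function.update_of_ne (Finset.ne_of_mem_erase hj)]]
      ring
    have h3 : gap i (Function.update S k z) = gap i S - 1 / (T : ℝ) * (g i z - g i (S k)) := by
      simp only [hgap, h2]; ring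
    have h4 : 1 / (T : ℝ) * (g i z - g i (S k)) ≤ 1 / (T : ℝ) * 2 :=
      mul_le_mul_of_nonneg_left
        (by linarith [(abs_le.1 (hg i z)).2, (abs_le.1 (hg i (S k))).1]) (by positivity)
    have h5 : (2 : ℝ) / T = 1 / (T : ℝ) * 2 := by ring
    linarith
  refine (one_sub_le_measureReal_pi_of_bounded_differences p hT hdiff hδ).trans
    (measureReal_mono fun S hS i => ?_)
  have h1 : sampleExp (fun z => (p z).toReal) (fun S => ⨆ i, gap i S) ≤ m :=
    (sampleExp_mono (fun z => ENNReal.toReal_nonneg) fun S => ciSup_le fun i => hq i S).trans hm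
  have h2 : (⨆ i, gap i S) ≤ _ := hS
  have h3 := le_ciSup (hbdd S) i
  linarith

end UniformDeviation

/-! ### Trace inequalities for positive semidefinite matrices -/

section TraceInequalities

variable {Q : Type*} [Fintype Q] {A B E G N W : Matrix Q Q ℂ}

lemma trace_mul_nonneg (hA : A.PosSemidef) (hB : B.PosSemidef) :
    0 ≤ (A * B).trace.re := by
  classical
  obtain ⟨C, rfl⟩ := CStarAlgebra.nonneg_iff_eq_star_mul_self.1 hA.nonneg
  rw [Matrix.star_eq_conjTranspose, Matrix.mul_assoc, Matrix.trace_mul_comm]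
  exact (Complex.le_def.1 (hB.mul_mul_conjTranspose_same C).trace_nonneg).1

lemma trace_mul_le [DecidableEq Q] (hE : (1 - E).PosSemidef) (hA : A.PosSemidef) :
    (E * A).trace.re ≤ A.trace.re := by
  have := trace_mul_nonneg hE hA
  rw [Matrix.sub_mul, Matrix.one_mul, Matrix.trace_sub, Complex.sub_re] at this
  linarith

/-- The square of an effect is again an effect. -/
lemma posSemidef_one_sub_mul_self [DecidableEq Q] (hE : E.PosSemidef)
    (hE1 : (1 - E).PosSemidef) : (1 - E * E).PosSemidef := by
  have h1 := hE1.mul_mul_conjTranspose_same E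
  have h2 := hE.mul_mul_conjTranspose_same (1 - E)
  rw [hE.isHermitian.eq] at h1
  rw [hE1.isHermitian.eq] at h2
  convert hE1.add (h1.add h2) using 1
  noncomm_ring

/-- A weighted Cauchy–Schwarz bound: for an effect `E`, the trace of `E * A` is at most the
mean of `Tr N` and `Tr (N⁻¹ A²)`. It is the positivity of the trace of
`(A N⁻¹ - E) N (A N⁻¹ - E)ᴴ`. -/
lemma two_mul_trace_mul_le [DecidableEq Q] (hE : E.PosSemidef) (hE1 : (1 - E).PosSemidef)
    (hA : A.IsHermitian) (hN : N.PosSemidef) (hG : G.PosSemidef) (hGN : G * N = 1) :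
    2 * (E * A).trace.re ≤ N.trace.re + (G * (A * A)).trace.re := by
  have hNG : N * G = 1 := mul_eq_one_comm.1 hGN
  have h1 := (Complex.le_def.1 (hN.mul_mul_conjTranspose_same (A * G - E)).trace_nonneg).1
  have h2 : (A * G - E) * N * (A * G - E).conjTranspose
      = A * G * A - A * E - E * A + E * N * E := by
    rw [Matrix.conjTranspose_sub, Matrix.conjTranspose_mul, hA.eq, hG.isHermitian.eq,
      hE.isHermitian.eq, sub_mul, mul_assoc A G N, hGN, mul_one, sub_mul, mul_sub, mul_sub,
      mul_assoc E N (G * A), ← mul_assoc N G A, hNG, one_mul, mul_assoc A G A]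
    abel
  have h3 : (A * G * A).trace = (G * (A * A)).trace := by
    rw [mul_assoc, Matrix.trace_mul_comm, mul_assoc]
  have h4 : (E * N * E).trace = ((E * E) * N).trace := by
    rw [mul_assoc, Matrix.trace_mul_comm, mul_assoc, Matrix.trace_mul_comm]
  have h5 := trace_mul_le (posSemidef_one_sub_mul_self hE hE1) hN
  rw [h2, Matrix.trace_add, Matrix.trace_sub, Matrix.trace_sub, h3, h4,
    Matrix.trace_mul_comm A E] at h1
  simp only [Complex.add_re, Complex.sub_re, Complex.zero_re] at h1
  linarith

lemma trace_inv_mul_mul_self_le [DecidableEq Q] (hA : A.PosSemidef) {ε : ℝ} (hε : 0 ≤ ε)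
    (hG : G.PosSemidef) (hGN : G * (A + (ε : ℂ) • 1) = 1) :
    (G * (A * A)).trace.re ≤ A.trace.re := by
  have h1 : G * (A * A) = A - (ε : ℂ) • (G * A) := by
    have h : G * A = 1 - (ε : ℂ) • G := by
      rw [← hGN, mul_add, mul_smul_comm, mul_one, add_sub_cancel_right]
    nth_rewrite 1 [← mul_assoc, h]
    rw [sub_mul, one_mul, smul_mul_assoc]
  have h2 := mul_nonneg hε (trace_mul_nonneg hG hA)
  rw [h1, Matrix.trace_sub, Matrix.trace_smul, Complex.sub_re, smul_eq_mul, Complex.re_ofReal_mul]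
  linarith

/-- A linear functional `E ↦ Tr (E W)` attains its minimum over the effects, namely at the spectral
projection of `W` onto the negative half-line. -/
lemma exists_effect_trace_mul_le [DecidableEq Q] (hW : W.IsHermitian) :
    ∃ E : Matrix Q Q ℂ, E.PosSemidef ∧ (1 - E).PosSemidef ∧
      ∀ F : Matrix Q Q ℂ, F.PosSemidef → (1 - F).PosSemidef →
        (E * W).trace.re ≤ (F * W).trace.re := by
  have hsa : IsSelfAdjoint W := hW
  have hc : ∀ f : ℝ → ℝ, ContinuousOn f (spectrum ℝ W) :=
    fun f => (Matrix.finite_real_spectrum (A := W)).continuousOn f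
  set E : Matrix Q Q ℂ := cfc (fun t : ℝ => if t < 0 then 1 else 0) W with hE
  have hEW : E * W = cfc (fun t : ℝ => (if t < 0 then 1 else 0) * t) W := by
    rw [cfc_mul _ _ W (hc _) (hc _), cfc_id' ℝ W]
  have hneg : (-(E * W)).PosSemidef := by
    rw [← Matrix.nonneg_iff_posSemidef]
    rw [hEW, ← cfc_neg]
    refine cfc_nonneg fun t _ => ?_
    split_ifs with h
    · simpa using h.le
    · simp
  have hpos : (W - E * W).PosSemidef := by
    rw [← Matrix.nonneg_iff_posSemidef]
    have h : W - E * W = cfc (fun t : ℝ => t - (if t < 0 then 1 else 0) * t) W := by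
      rw [cfc_sub _ _ W (hc _) (hc _), cfc_id' ℝ W, hEW]
    rw [h]
    exact cfc_nonneg fun t _ => by split_ifs with h <;> simp [not_lt.1, *]
  refine ⟨E, ?_, ?_, fun F hF hF1 => ?_⟩
  · rw [← Matrix.nonneg_iff_posSemidef]
    exact cfc_nonneg fun t _ => by split_ifs <;> simp
  · rw [← Matrix.nonneg_iff_posSemidef, ← cfc_one ℝ W, hE, ← cfc_sub _ _ W (hc _) (hc _)]
    exact cfc_nonneg fun t _ => by split_ifs <;> simp
  · have h1 := trace_mul_nonneg hF hpos
    have h2 := trace_mul_le hF1 hneg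
    have h3 : F * W = F * (W - E * W) - F * (-(E * W)) := by noncomm_ring
    rw [h3, Matrix.trace_sub, Complex.sub_re]
    rw [Matrix.trace_neg, Complex.neg_re] at h2
    linarith

end TraceInequalities

/-! ### Binary measurements and the linear loss -/

section BinaryLoss

variable {X Q : Type*} [Fintype Q] [DecidableEq Q]

/-- The state `ρ(x)`, with sign `+` for the class `0` and `-` for the class `1`. Up to a constant,
the loss of a binary measurement at `z` is the trace of its effect `Π₁` against this matrix. -/
noncomputable def signedState (ρ : X → DensityMatrix Q) (z : Fin 2 × X) : Matrix Q Q ℂ :=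
  if z.1 = 0 then (ρ z.2).mat else -(ρ z.2).mat

omit [DecidableEq Q] in
lemma isHermitian_signedState (ρ : X → DensityMatrix Q) (z : Fin 2 × X) :
    (signedState ρ z).IsHermitian := by
  rw [signedState]
  split_ifs
  · exact (ρ z.2).posSemidef.isHermitian
  · exact (ρ z.2).posSemidef.isHermitian.neg

lemma signedState_mul_self (ρ : X → DensityMatrix Q) (z : Fin 2 × X) :
    signedState ρ z * signedState ρ z = (ρ z.2).mat ^ 2 := by
  rw [signedState]
  split_ifs <;> simp [sq]

lemma POVM.op_zero (M : POVM (Fin 2) Q) : M.op 0 = 1 - M.op 1 := by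
  rw [← M.sum_eq_one, Fin.sum_univ_two, add_sub_cancel_right]

lemma POVM.posSemidef_one_sub (M : POVM (Fin 2) Q) : (1 - M.op 1).PosSemidef :=
  M.op_zero ▸ M.posSemidef 0

lemma loss_eq (ρ : X → DensityMatrix Q) (M : POVM (Fin 2) Q) (z : Fin 2 × X) :
    loss ρ M z = (M.op 1 * signedState ρ z).trace.re + if z.1 = 0 then 0 else 1 := by
  obtain ⟨c, x⟩ := z
  fin_cases c
  · simp [loss, signedState, show Finset.univ.erase (0 : Fin 2) = {1} from rfl]
  · simp only [loss, signedState, Fin.mk_one, show Finset.univ.erase (1 : Fin 2) = {0} from rfl,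
      Finset.sum_singleton, one_ne_zero, if_false, M.op_zero, Matrix.sub_mul, Matrix.one_mul,
      Matrix.trace_sub, (ρ x).trace_eq_one, Matrix.mul_neg, Matrix.trace_neg, Complex.sub_re,
      Complex.neg_re, Complex.one_re]
    ring

lemma loss_nonneg (ρ : X → DensityMatrix Q) (M : POVM (Fin 2) Q) (z : Fin 2 × X) :
    0 ≤ loss ρ M z :=
  Finset.sum_nonneg fun c _ => trace_mul_nonneg (M.posSemidef c) (ρ z.2).posSemidef

lemma loss_le_one (ρ : X → DensityMatrix Q) (M : POVM (Fin 2) Q) (z : Fin 2 × X) :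
    loss ρ M z ≤ 1 := by
  have h1 := trace_mul_nonneg (M.posSemidef 1) (ρ z.2).posSemidef
  have h2 := trace_mul_le M.posSemidef_one_sub (ρ z.2).posSemidef
  rw [(ρ z.2).trace_eq_one, Complex.one_re] at h2
  rw [loss_eq, signedState]
  split_ifs
  · linarith
  · rw [Matrix.mul_neg, Matrix.trace_neg, Complex.neg_re]
    linarith

/-- The real part of `Tr (E A)`, as a real linear function of `A`. -/
noncomputable def traceMulLeft (E : Matrix Q Q ℂ) : Matrix Q Q ℂ →ₗ[ℝ] ℝ :=
  Complex.reLm ∘ₗ Matrix.traceLinearMap Q ℝ ℂ ∘ₗ LinearMap.mulLeft ℝ E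

lemma traceMulLeft_apply (E A : Matrix Q Q ℂ) : traceMulLeft E A = (E * A).trace.re := rfl

/-- Every weighted sum of losses attains its minimum over the binary measurements. -/
lemma exists_povm_sum_mul_loss_le {κ : Type*} [Fintype κ] (ρ : X → DensityMatrix Q)
    (a : κ → ℝ) (s : κ → Fin 2 × X) :
    ∃ M : POVM (Fin 2) Q, ∀ M' : POVM (Fin 2) Q,
      ∑ i, a i * loss ρ M (s i) ≤ ∑ i, a i * loss ρ M' (s i) := by
  have hW : (∑ i, a i • signedState ρ (s i)).IsHermitian :=
    isSelfAdjoint_sum _ fun i _ =>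
      IsSelfAdjoint.smul (IsSelfAdjoint.all (a i)) (isHermitian_signedState ρ (s i))
  obtain ⟨E, hE, hE1, hmin⟩ := exists_effect_trace_mul_le hW
  have key : ∀ M : POVM (Fin 2) Q, ∑ i, a i * loss ρ M (s i)
      = (M.op 1 * ∑ i, a i • signedState ρ (s i)).trace.re
        + ∑ i, a i * (if (s i).1 = 0 then 0 else 1) := by
    intro M
    rw [← traceMulLeft_apply, map_sum, ← Finset.sum_add_distrib]
    refine Finset.sum_congr rfl fun i _ => ?_
    rw [map_smul, loss_eq, traceMulLeft_apply, smul_eq_mul, mul_add]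
  refine ⟨⟨![1 - E, E], fun c => ?_, by simp⟩, fun M' => ?_⟩
  · fin_cases c
    · exact hE1
    · exact hE
  · rw [key, key]
    have := hmin _ (M'.posSemidef 1) M'.posSemidef_one_sub
    simpa using this

lemma exists_isERM {T : ℕ} (ρ : X → DensityMatrix Q) (S : Fin T → Fin 2 × X) :
    ∃ M : POVM (Fin 2) Q, IsERM ρ S M := by
  obtain ⟨M, hM⟩ := exists_povm_sum_mul_loss_le ρ (fun _ => 1 / (T : ℝ)) S
  exact ⟨M, fun M' => by simpa only [empRisk, Finset.mul_sum] using hM M'⟩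

lemma exists_isOptimal [Fintype X] (P : PMF (Fin 2 × X)) (ρ : X → DensityMatrix Q) :
    ∃ M : POVM (Fin 2) Q, IsOptimal P ρ M :=
  exists_povm_sum_mul_loss_le ρ (fun z => (P z).toReal) id

lemma IsOptimal.genError_eq [Fintype X] {P : PMF (Fin 2 × X)} {ρ : X → DensityMatrix Q}
    {M₀ : POVM (Fin 2) Q} (h : IsOptimal P ρ M₀) (M : POVM (Fin 2) Q) :
    genError P ρ M = risk P ρ M - risk P ρ M₀ := by
  have : Nonempty (POVM (Fin 2) Q) := ⟨M₀⟩
  have hbdd : BddBelow (Set.range fun M' : POVM (Fin 2) Q => risk P ρ M') :=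
    ⟨risk P ρ M₀, by rintro _ ⟨M', rfl⟩; exact h M'⟩
  rw [genError, le_antisymm (ciInf_le hbdd M₀) (le_ciInf h)]

end BinaryLoss

/-! ### The trace of the root of the mean squared state -/

section MeanSquare

variable {X Q : Type*} [Fintype X] [Fintype Q] [DecidableEq Q]

/-- The mean squared state `∑_x P(x) ρ(x)²`. -/
noncomputable def meanSquare (P : PMF (Fin 2 × X)) (ρ : X → DensityMatrix Q) : Matrix Q Q ℂ :=
  ∑ x, (marginal P x : ℂ) • (ρ x).mat ^ 2

omit [Fintype X] in
lemma marginal_nonneg (P : PMF (Fin 2 × X)) (x : X) : 0 ≤ marginal P x :=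
  Finset.sum_nonneg fun _ _ => ENNReal.toReal_nonneg

lemma sum_marginal (P : PMF (Fin 2 × X)) : ∑ x, marginal P x = 1 := by
  rw [← sum_toReal_pmf P, Fintype.sum_prod_type_right]
  rfl

lemma posSemidef_meanSquare (P : PMF (Fin 2 × X)) (ρ : X → DensityMatrix Q) :
    (meanSquare P ρ).PosSemidef :=
  Matrix.posSemidef_sum _ fun x _ => ((ρ x).posSemidef.pow 2).smul
    (Complex.zero_le_real.2 (marginal_nonneg P x))

lemma meanSquare_eq_sum_signedState (P : PMF (Fin 2 × X)) (ρ : X → DensityMatrix Q) :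
    meanSquare P ρ = ∑ z, (P z).toReal • (signedState ρ z * signedState ρ z) := by
  simp only [signedState_mul_self]
  rw [Fintype.sum_prod_type_right]
  simp only [← Finset.sum_smul]
  rfl

lemma posSemidef_sqrt_meanSquare (P : PMF (Fin 2 × X)) (ρ : X → DensityMatrix Q) :
    (CFC.sqrt (meanSquare P ρ)).PosSemidef :=
  Matrix.nonneg_iff_posSemidef.1 (CFC.sqrt_nonneg _)

lemma sqrt_mul_sqrt_meanSquare (P : PMF (Fin 2 × X)) (ρ : X → DensityMatrix Q) :
    CFC.sqrt (meanSquare P ρ) * CFC.sqrt (meanSquare P ρ) = meanSquare P ρ :=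
  CFC.sqrt_mul_sqrt_self _ (posSemidef_meanSquare P ρ).nonneg

lemma trace_sqrt_meanSquare_pos (P : PMF (Fin 2 × X)) (ρ : X → DensityMatrix Q) :
    0 < (CFC.sqrt (meanSquare P ρ)).trace.re := by
  have h0 := posSemidef_sqrt_meanSquare P ρ
  have htr := Complex.le_def.1 h0.trace_nonneg
  refine lt_of_le_of_ne htr.1 fun h => ?_
  have hz : CFC.sqrt (meanSquare P ρ) = 0 :=
    h0.trace_eq_zero_iff.1 (Complex.ext h.symm htr.2.symm)
  have hV : meanSquare P ρ = 0 := by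
    rw [← sqrt_mul_sqrt_meanSquare, hz, mul_zero]
  have hterm : ∀ x ∈ Finset.univ, (marginal P x : ℂ) • (ρ x).mat ^ 2 = 0 :=
    (Finset.sum_eq_zero_iff_of_nonneg fun x _ => (((ρ x).posSemidef.pow 2).smul
      (Complex.zero_le_real.2 (marginal_nonneg P x))).nonneg).1 hV
  have hzero : ∀ x, marginal P x = 0 := by
    intro x
    refine (smul_eq_zero.1 (hterm x (Finset.mem_univ x))).elim Complex.ofReal_eq_zero.1 fun hx => ?_
    have h1 : (ρ x).mat.conjTranspose * (ρ x).mat = 0 := by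
      rw [(ρ x).posSemidef.isHermitian.eq, ← sq, hx]
    have h2 := (ρ x).trace_eq_one
    rw [Matrix.conjTranspose_mul_self_eq_zero.1 h1, Matrix.trace_zero] at h2
    exact absurd h2 zero_ne_one
  have := sum_marginal P
  simp [hzero] at this

end MeanSquare

/-! ### The generalization bound -/

section Generalization

variable {X Q : Type*} [Fintype X] [Fintype Q] [DecidableEq Q] {T : ℕ}

/-- The true mean of `signedState` minus its empirical mean on the sample `S`. -/
noncomputable def signedDeviation (P : PMF (Fin 2 × X)) (ρ : X → DensityMatrix Q)
    (S : Fin T → Fin 2 × X) : Matrix Q Q ℂ :=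
  ∑ z, (P z).toReal • signedState ρ z - (1 / (T : ℝ)) • ∑ k, signedState ρ (S k)

variable (P : PMF (Fin 2 × X)) (ρ : X → DensityMatrix Q)

omit [DecidableEq Q] in
lemma isHermitian_sum_signedState : (∑ z, (P z).toReal • signedState ρ z).IsHermitian :=
  isSelfAdjoint_sum _ fun z _ =>
    IsSelfAdjoint.smul (IsSelfAdjoint.all (P z).toReal) (isHermitian_signedState ρ z)

omit [DecidableEq Q] in
lemma isHermitian_signedDeviation (S : Fin T → Fin 2 × X) :
    (signedDeviation P ρ S).IsHermitian :=
  (isHermitian_sum_signedState P ρ).sub (IsSelfAdjoint.smul (IsSelfAdjoint.all (1 / (T : ℝ)))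
    (isSelfAdjoint_sum _ fun k _ => isHermitian_signedState ρ (S k)))

omit [DecidableEq Q] in
lemma sum_smul_centered_signedState :
    ∑ z, (P z).toReal • (∑ z', (P z').toReal • signedState ρ z' - signedState ρ z) = 0 := by
  simp only [smul_sub, Finset.sum_sub_distrib]
  rw [← Finset.sum_smul, sum_toReal_pmf, one_smul, sub_self]

omit [DecidableEq Q] in
lemma signedDeviation_eq (hT : 1 ≤ T) (S : Fin T → Fin 2 × X) :
    signedDeviation P ρ S = (1 / (T : ℝ)) •
      ∑ k, (∑ z', (P z').toReal • signedState ρ z' - signedState ρ (S k)) := by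
  have hT0 : (T : ℝ) ≠ 0 := by positivity
  rw [Finset.sum_sub_distrib, Finset.sum_const, Finset.card_univ, Fintype.card_fin, smul_sub,
    ← Nat.cast_smul_eq_nsmul ℝ, smul_smul, one_div_mul_cancel hT0, one_smul]
  rfl

omit [DecidableEq Q] in
lemma sampleExp_signedDeviation (hT : 1 ≤ T) :
    sampleExp (fun z => (P z).toReal) (fun S : Fin T → _ => signedDeviation P ρ S) = 0 := by
  simp only [signedDeviation_eq P ρ hT]
  have h := sampleExp_map (w := fun z => (P z).toReal)
    ((1 / (T : ℝ)) • LinearMap.id (R := ℝ) (M := Matrix Q Q ℂ))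
    (fun S : Fin T → Fin 2 × X =>
      ∑ k, (∑ z', (P z').toReal • signedState ρ z' - signedState ρ (S k)))
  rw [sampleExp_sum_of_centered (sum_toReal_pmf P) (sum_smul_centered_signedState P ρ),
    map_zero] at h
  exact h

/-- The matrix-valued variance of the empirical mean is `1 / T` times the variance of a single
signed state, which is dominated by its second moment. -/
lemma sampleExp_trace_mul_signedDeviation_sq_le (hT : 1 ≤ T) {G : Matrix Q Q ℂ}
    (hG : G.PosSemidef) :
    sampleExp (fun z => (P z).toReal)
      (fun S : Fin T → _ => traceMulLeft G (signedDeviation P ρ S * signedDeviation P ρ S))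
        ≤ 1 / (T : ℝ) * traceMulLeft G (meanSquare P ρ) := by
  have hT0 : (T : ℝ) ≠ 0 := by positivity
  set W := ∑ z', (P z').toReal • signedState ρ z' with hW
  have h1 : ∀ S : Fin T → Fin 2 × X, signedDeviation P ρ S * signedDeviation P ρ S
      = ((1 / (T : ℝ) * (1 / T)) • LinearMap.id (R := ℝ) (M := Matrix Q Q ℂ))
        ((∑ k, (W - signedState ρ (S k))) * ∑ k, (W - signedState ρ (S k))) := by
    intro S
    rw [signedDeviation_eq P ρ hT, smul_mul_smul_comm]
    rfl
  have h2 : ∑ z, (P z).toReal • ((W - signedState ρ z) * (W - signedState ρ z))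
      = meanSquare P ρ - W * W := by
    have h : ∀ z, (P z).toReal • ((W - signedState ρ z) * (W - signedState ρ z))
        = (P z).toReal • (W * W) - W * ((P z).toReal • signedState ρ z)
          - ((P z).toReal • signedState ρ z) * W
          + (P z).toReal • (signedState ρ z * signedState ρ z) := by
      intro z
      rw [mul_smul_comm, smul_mul_assoc, ← smul_sub, ← smul_sub, ← smul_add]
      congr 1
      noncomm_ring
    simp only [h, Finset.sum_add_distrib, Finset.sum_sub_distrib]
    rw [← Finset.sum_smul, sum_toReal_pmf, one_smul, ← Finset.mul_sum, ← Finset.sum_mul,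
      ← meanSquare_eq_sum_signedState, ← hW]
    abel
  have h3 : 0 ≤ traceMulLeft G (W * W) := by
    have h := Matrix.posSemidef_conjTranspose_mul_self W
    rw [(isHermitian_sum_signedState P ρ).eq] at h
    exact trace_mul_nonneg hG h
  rw [sampleExp_map]
  simp only [h1]
  rw [sampleExp_map, sampleExp_sum_mul_sum_of_centered (sum_toReal_pmf P)
    (sum_smul_centered_signedState P ρ), h2, LinearMap.smul_apply, LinearMap.id_apply, smul_smul,
    mul_assoc, one_div_mul_cancel hT0, mul_one, map_smul, smul_eq_mul, map_sub]
  exact mul_le_mul_of_nonneg_left (by linarith) (by positivity)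

/-- With high probability, the excess risks over a fixed `M₀` of all binary measurements exceed their
empirical counterparts by no more than the generalization bound. -/
lemma one_sub_le_measureReal_pi_excess_risk_le [MeasurableSpace X] [MeasurableSingletonClass X]
    (hT : 1 ≤ T) (M₀ : POVM (Fin 2) Q) {δ : ℝ} (hδ : 0 < δ) :
    1 - δ ≤ (Measure.pi fun _ : Fin T => P.toMeasure).real
      {S | ∀ M : POVM (Fin 2) Q, risk P ρ M - risk P ρ M₀ - (empRisk ρ S M - empRisk ρ S M₀)
        ≤ 2 * √(genBound P ρ / T) + √(2 * Real.log (1 / δ) / T)} := by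
  have hT0 : (0 : ℝ) < T := by exact_mod_cast hT
  have : Nonempty (POVM (Fin 2) Q) := ⟨M₀⟩
  set R := CFC.sqrt (meanSquare P ρ) with hR
  set t := R.trace.re with ht
  have ht0 : 0 < t := trace_sqrt_meanSquare_pos P ρ
  have hd : (0 : ℝ) < Fintype.card Q := by
    have : Nonempty Q := by
      by_contra h
      rw [not_nonempty_iff] at h
      simp [ht, Matrix.trace] at ht0
    exact_mod_cast Fintype.card_pos
  set c : ℝ := √(1 / T) with hc
  have hc0 : 0 < c := Real.sqrt_pos.2 (by positivity)
  have hcc : c * c = 1 / T := Real.mul_self_sqrt (by positivity)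
  have hroot : √(genBound P ρ / T) = c * t := by
    rw [div_eq_mul_one_div, mul_comm, Real.sqrt_mul (by positivity), genBound]
    congr 1
    exact Real.sqrt_sq ht0.le
  -- The reference matrix is the root of the variance bound, made invertible by a shift of `ε`,
  -- chosen such that the shift costs no more than the root itself.
  set ε : ℝ := 2 * (c * t) / Fintype.card Q with hε
  have hε0 : 0 < ε := by positivity
  have hcR : ((c : ℂ) • R).PosSemidef :=
    (posSemidef_sqrt_meanSquare P ρ).smul (Complex.zero_le_real.2 hc0.le)
  set N : Matrix Q Q ℂ := (c : ℂ) • R + (ε : ℂ) • 1 with hN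
  have hNpos : N.PosDef :=
    Matrix.PosDef.posSemidef_add hcR (Matrix.PosDef.one.smul (by exact_mod_cast hε0))
  have hGN : N⁻¹ * N = 1 :=
    Matrix.nonsing_inv_mul _ ((Matrix.isUnit_iff_isUnit_det _).1 hNpos.isUnit)
  have hG : N⁻¹.PosSemidef := hNpos.inv.posSemidef
  have htrN : N.trace.re = 3 * (c * t) := by
    rw [hN, Matrix.trace_add, Matrix.trace_smul, Matrix.trace_smul, Matrix.trace_one,
      Complex.add_re, smul_eq_mul, smul_eq_mul, Complex.re_ofReal_mul, Complex.re_ofReal_mul,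
      Complex.natCast_re, hε]
    field_simp
    ring
  have hGV : 1 / (T : ℝ) * traceMulLeft N⁻¹ (meanSquare P ρ) ≤ c * t := by
    have h1 := trace_inv_mul_mul_self_le hcR hε0.le hG hGN
    rw [Matrix.trace_smul, smul_eq_mul, Complex.re_ofReal_mul, smul_mul_smul_comm,
      sqrt_mul_sqrt_meanSquare, ← Complex.ofReal_mul, hcc, Matrix.mul_smul, Matrix.trace_smul,
      smul_eq_mul, Complex.re_ofReal_mul] at h1
    exact h1
  set q : (Fin T → Fin 2 × X) → ℝ := fun S =>
    (1 / 2) * (N.trace.re + traceMulLeft N⁻¹ (signedDeviation P ρ S * signedDeviation P ρ S))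
      + -traceMulLeft (M₀.op 1) (signedDeviation P ρ S) with hq
  have hrisk : ∀ (M : POVM (Fin 2) Q) (S : Fin T → Fin 2 × X),
      ∑ z, (P z).toReal * (loss ρ M z - loss ρ M₀ z)
          - 1 / (T : ℝ) * ∑ k, (loss ρ M (S k) - loss ρ M₀ (S k))
        = traceMulLeft (M.op 1) (signedDeviation P ρ S)
          - traceMulLeft (M₀.op 1) (signedDeviation P ρ S) := by
    intro M S
    have h : ∀ z, loss ρ M z - loss ρ M₀ z = traceMulLeft (M.op 1) (signedState ρ z)
        - traceMulLeft (M₀.op 1) (signedState ρ z) := by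
      intro z
      rw [loss_eq, loss_eq, traceMulLeft_apply, traceMulLeft_apply]
      ring
    simp only [h, signedDeviation, map_sub, map_sum, map_smul, smul_eq_mul, mul_sub,
      Finset.sum_sub_distrib]
    ring
  have hdom : ∀ (M : POVM (Fin 2) Q) (S : Fin T → Fin 2 × X),
      ∑ z, (P z).toReal * (loss ρ M z - loss ρ M₀ z)
          - 1 / (T : ℝ) * ∑ k, (loss ρ M (S k) - loss ρ M₀ (S k)) ≤ q S := by
    intro M S
    have h := two_mul_trace_mul_le (M.posSemidef 1) M.posSemidef_one_sub
      (isHermitian_signedDeviation P ρ S) hNpos.posSemidef hG hGN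
    rw [hrisk]
    simp only [hq, traceMulLeft_apply] at h ⊢
    linarith
  have hmean : sampleExp (fun z => (P z).toReal) q ≤ 2 * (c * t) := by
    have h1 := sampleExp_trace_mul_signedDeviation_sq_le P ρ hT hG
    have h2 : sampleExp (fun z => (P z).toReal)
        (fun S : Fin T → _ => -traceMulLeft (M₀.op 1) (signedDeviation P ρ S)) = 0 := by
      have := sampleExp_map (w := fun z => (P z).toReal) (-traceMulLeft (M₀.op 1))
        (fun S : Fin T → _ => signedDeviation P ρ S)
      rw [sampleExp_signedDeviation P ρ hT, map_zero] at this
      exact this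
    have h3 := sampleExp_map (w := fun z => (P z).toReal) (LinearMap.mulLeft ℝ (1 / 2 : ℝ))
      (fun S : Fin T → _ => N.trace.re
        + traceMulLeft N⁻¹ (signedDeviation P ρ S * signedDeviation P ρ S))
    rw [sampleExp_add, sampleExp_const (sum_toReal_pmf P)] at h3
    simp only [LinearMap.mulLeft_apply] at h3
    rw [hq, sampleExp_add, h2, h3, htrN]
    linarith
  have hmain := one_sub_le_measureReal_pi_deviation_le P hT
    (g := fun (M : POVM (Fin 2) Q) z => loss ρ M z - loss ρ M₀ z)
    (fun M z => abs_le.2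
      ⟨by linarith [loss_nonneg ρ M z, loss_le_one ρ M₀ z],
        by linarith [loss_le_one ρ M z, loss_nonneg ρ M₀ z]⟩) hdom hmean hδ
  rw [hroot]
  convert hmain using 4 with S M
  simp only [risk, empRisk, mul_sub, Finset.sum_sub_distrib]

end Generalization

/-! ### The Rényi mutual information of a classical-quantum state -/

section Renyi

variable {X Q : Type*} [Fintype X] [DecidableEq X] [Fintype Q] [DecidableEq Q]

/-- The functional calculus of a diagonal matrix acts entrywise. -/
lemma cfc_diagonal (f : ℝ → ℝ) (p : X → ℝ) :
    cfc f (Matrix.diagonal fun x => (p x : ℂ)) = Matrix.diagonal fun x => (f (p x) : ℂ) := by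
  set D : Matrix X X ℂ := Matrix.diagonal fun x => (p x : ℂ) with hD
  have hsa : IsSelfAdjoint D :=
    Matrix.isHermitian_diagonal_of_self_adjoint _ (by ext x; simp)
  -- On the finite set of spectral values and diagonal entries, `f` agrees with a polynomial.
  set s : Finset ℝ :=
    (Matrix.finite_real_spectrum (A := D)).toFinset ∪ Finset.univ.image p with hs
  set r := Lagrange.interpolate s id f
  have hr : ∀ a ∈ s, r.eval a = f a := fun a ha =>
    Lagrange.eval_interpolate_at_node f (Set.injOn_id _) ha
  have h1 : cfc f D = Polynomial.aeval D r := by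
    rw [← cfc_polynomial r D]
    exact cfc_congr fun a ha => (hr a (by simp [hs, ha])).symm
  have h2 : Polynomial.aeval D r
      = Matrix.diagonal (Polynomial.aeval (fun x => (p x : ℂ)) r) :=
    Polynomial.aeval_algHom_apply (Matrix.diagonalAlgHom ℝ) (fun x => (p x : ℂ)) r
  rw [h1, h2]
  congr 1
  ext x
  have h3 := Polynomial.aeval_algHom_apply (Pi.evalAlgHom ℝ (fun _ : X => ℂ) x)
    (fun x => (p x : ℂ)) r
  refine h3.symm.trans ?_
  rw [← hr (p x) (by simp [hs])]
  exact Polynomial.aeval_algebraMap_apply_eq_algebraMap_eval (A := ℂ) (p x) r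

lemma rpow_diagonal {p : X → ℝ} (hp : ∀ x, 0 ≤ p x) (y : ℝ) :
    (Matrix.diagonal fun x => (p x : ℂ)) ^ y = Matrix.diagonal fun x => ((p x ^ y : ℝ) : ℂ) := by
  have h : (0 : Matrix X X ℂ) ≤ Matrix.diagonal fun x => (p x : ℂ) :=
    (Matrix.PosSemidef.diagonal fun x => Complex.zero_le_real.2 (hp x)).nonneg
  rw [CFC.rpow_eq_cfc_real h, cfc_diagonal]

/-- The operator `∑_x |x⟩⟨x| ⊗ A(x)`, diagonal in the classical register. -/
def classicalQuantum (A : X → Matrix Q Q ℂ) : Matrix (X × Q) (X × Q) ℂ :=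
  Matrix.of fun i j => if i.1 = j.1 then A i.1 i.2 j.2 else 0

omit [Fintype X] [Fintype Q] [DecidableEq Q] in
lemma classicalQuantum_apply (A : X → Matrix Q Q ℂ) (i j : X × Q) :
    classicalQuantum A i j = if i.1 = j.1 then A i.1 i.2 j.2 else 0 := rfl

omit [DecidableEq Q] in
lemma classicalQuantum_mul (A B : X → Matrix Q Q ℂ) :
    classicalQuantum A * classicalQuantum B = classicalQuantum fun x => A x * B x := by
  ext ⟨x, i⟩ ⟨y, j⟩
  simp only [Matrix.mul_apply, classicalQuantum_apply, Fintype.sum_prod_type]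
  rw [Finset.sum_eq_single x (fun z _ hz => by simp [hz.symm]) (by simp)]
  by_cases h : x = y <;> simp [h]

omit [DecidableEq Q] in
lemma posSemidef_classicalQuantum {A : X → Matrix Q Q ℂ} (hA : ∀ x, (A x).PosSemidef) :
    (classicalQuantum A).PosSemidef := by
  have h : classicalQuantum A = ∑ x, Matrix.diagonal (Pi.single x (1 : ℂ)) ⊗ₖ A x := by
    ext ⟨x, i⟩ ⟨y, j⟩
    rw [Matrix.sum_apply, Finset.sum_eq_single x]
    · by_cases h : x = y <;> simp [classicalQuantum_apply, h]
    · intro z _ hz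
      by_cases h : x = y <;> simp [h, Pi.single_apply]
      simp [← h, hz.symm]
    · simp
  rw [h]
  refine Matrix.posSemidef_sum _ fun x _ => Matrix.PosSemidef.kronecker
    (Matrix.PosSemidef.diagonal fun y => ?_) (hA x)
  by_cases h : y = x <;> simp [h]

omit [Fintype Q] [DecidableEq Q] in
lemma traceFst_classicalQuantum (A : X → Matrix Q Q ℂ) :
    traceFst (classicalQuantum A) = ∑ x, A x := by
  ext i j
  simp [traceFst, classicalQuantum_apply, Matrix.sum_apply]

omit [Fintype X] [DecidableEq Q] in
lemma traceSnd_classicalQuantum (A : X → Matrix Q Q ℂ) :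
    traceSnd (classicalQuantum A) = Matrix.diagonal fun x => (A x).trace := by
  ext x y
  by_cases h : x = y <;> simp [traceSnd, classicalQuantum_apply, Matrix.trace, h]

omit [Fintype X] [Fintype Q] in
lemma diagonal_kronecker_one (d : X → ℂ) :
    Matrix.diagonal d ⊗ₖ (1 : Matrix Q Q ℂ) = classicalQuantum fun x => d x • 1 := by
  ext ⟨x, i⟩ ⟨y, j⟩
  by_cases h : x = y <;> simp [classicalQuantum_apply, h]

omit [DecidableEq Q] in
lemma traceFst_cqState (P : PMF (Fin 2 × X)) (ρ : X → DensityMatrix Q) :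
    traceFst (cqState P ρ) = classicalQuantum fun x => (marginal P x : ℂ) • (ρ x).mat := by
  ext ⟨x, i⟩ ⟨y, j⟩
  simp only [traceFst, cqState, classicalQuantum_apply, Matrix.of_apply, Matrix.sum_apply,
    Matrix.smul_apply, Matrix.kroneckerMap_apply, Matrix.single_apply, marginal]
  by_cases h : x = y
  · subst h
    simp [Fin.sum_univ_two, add_mul]
  · have : ∀ z, ¬ (z = x ∧ z = y) := fun z hz => h (hz.1.symm.trans hz.2)
    simp [h, this]

/-- For a classical-quantum state, conjugating the square by the inverse root of the marginal leaves
`P(x)⁻¹ P(x)² ρ(x)² = P(x) ρ(x)²` in the block of `x`, also when `P(x) = 0`. -/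
lemma renyiMutualInfo_two_traceFst_cqState (P : PMF (Fin 2 × X)) (ρ : X → DensityMatrix Q) :
    renyiMutualInfo 2 (traceFst (cqState P ρ))
      = 2 * Real.logb 2 (CFC.sqrt (meanSquare P ρ)).trace.re := by
  have hpos : (classicalQuantum fun x => (marginal P x : ℂ) • (ρ x).mat).PosSemidef :=
    posSemidef_classicalQuantum fun x =>
      (ρ x).posSemidef.smul (Complex.zero_le_real.2 (marginal_nonneg P x))
  have hsq : (classicalQuantum fun x => (marginal P x : ℂ) • (ρ x).mat) ^ (2 : ℝ)
      = classicalQuantum fun x =>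
        ((marginal P x : ℂ) • (ρ x).mat) * ((marginal P x : ℂ) • (ρ x).mat) := by
    have h := CFC.rpow_natCast _ 2 hpos.nonneg
    rw [Nat.cast_ofNat] at h
    rw [h, sq, classicalQuantum_mul]
  have hsnd : traceSnd (classicalQuantum fun x => (marginal P x : ℂ) • (ρ x).mat)
      = Matrix.diagonal fun x => (marginal P x : ℂ) := by
    rw [traceSnd_classicalQuantum]
    simp [Matrix.trace_smul, DensityMatrix.trace_eq_one]
  have hblock : ∀ x, ((marginal P x ^ ((1 - 2 : ℝ) / 2) : ℝ) : ℂ) * (marginal P x) *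
      (marginal P x) * ((marginal P x ^ ((1 - 2 : ℝ) / 2) : ℝ) : ℂ) = marginal P x := by
    intro x
    have h0 := marginal_nonneg P x
    simp only [← Complex.ofReal_mul]
    congr 1
    rcases h0.eq_or_lt with h | h
    · simp [← h]
    · have : marginal P x ^ ((1 - 2 : ℝ) / 2) * marginal P x ^ ((1 - 2 : ℝ) / 2)
          = (marginal P x)⁻¹ := by
        rw [← Real.rpow_add h, ← Real.rpow_neg_one]
        norm_num
      calc _ = marginal P x ^ ((1 - 2 : ℝ) / 2) * marginal P x ^ ((1 - 2 : ℝ) / 2)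
            * marginal P x * marginal P x := by ring
        _ = _ := by rw [this]; field_simp
  have hsum : ∑ x, ((marginal P x ^ ((1 - 2 : ℝ) / 2) : ℝ) : ℂ) • (1 : Matrix Q Q ℂ)
        * (((marginal P x : ℂ) • (ρ x).mat) * ((marginal P x : ℂ) • (ρ x).mat))
        * (((marginal P x ^ ((1 - 2 : ℝ) / 2) : ℝ) : ℂ) • (1 : Matrix Q Q ℂ))
      = meanSquare P ρ := by
    refine Finset.sum_congr rfl fun x _ => ?_
    rw [smul_mul_smul_comm, smul_mul_smul_comm, smul_mul_smul_comm, one_mul, mul_one, ← mul_assoc,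
      hblock, sq]
  simp only [renyiMutualInfo]
  rw [traceFst_cqState, hsnd, rpow_diagonal (marginal_nonneg P), diagonal_kronecker_one, hsq,
    classicalQuantum_mul, classicalQuantum_mul, traceFst_classicalQuantum, hsum,
    CFC.sqrt_eq_rpow, show (2 : ℝ) / (2 - 1) = 2 by norm_num]

lemma genBound_eq_two_rpow_renyiMutualInfo (P : PMF (Fin 2 × X)) (ρ : X → DensityMatrix Q) :
    genBound P ρ = (2 : ℝ) ^ renyiMutualInfo 2 (traceFst (cqState P ρ)) := by
  rw [renyiMutualInfo_two_traceFst_cqState, mul_comm, Real.rpow_mul zero_le_two,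
    Real.rpow_logb zero_lt_two (by norm_num) (trace_sqrt_meanSquare_pos P ρ), Real.rpow_two]
  rfl

end Renyi

end QML

theorem theorem1 {X Q : Type*} [Fintype X] [DecidableEq X] [MeasurableSpace X]
    [MeasurableSingletonClass X] [Fintype Q] [DecidableEq Q]
    (P : PMF (Fin 2 × X)) (ρ : X → QML.DensityMatrix Q) :
    QML.genBound P ρ
        = (2 : ℝ) ^ QML.renyiMutualInfo 2 (QML.traceFst (QML.cqState P ρ)) ∧
      (∃ M : QML.POVM (Fin 2) Q, QML.IsOptimal P ρ M) ∧
      ∀ T : ℕ, 1 ≤ T →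
        (∀ S : Fin T → Fin 2 × X, ∃ M : QML.POVM (Fin 2) Q, QML.IsERM ρ S M) ∧
        ∀ δ : ℝ, 0 < δ →
          1 - δ ≤ (Measure.pi fun _ : Fin T => P.toMeasure).real
            {S | ∀ M : QML.POVM (Fin 2) Q, QML.IsERM ρ S M →
              QML.genError P ρ M
                ≤ 2 * √(QML.genBound P ρ / T) + √(2 * Real.log (1 / δ) / T)} := by
  refine ⟨QML.genBound_eq_two_rpow_renyiMutualInfo P ρ, QML.exists_isOptimal P ρ,
    fun T hT => ⟨QML.exists_isERM ρ, fun δ hδ => ?_⟩⟩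
  obtain ⟨M₀, hM₀⟩ := QML.exists_isOptimal P ρ
  refine (QML.one_sub_le_measureReal_pi_excess_risk_le P ρ hT M₀ hδ).trans
    (measureReal_mono fun S hS M hM => ?_)
  rw [hM₀.genError_eq]
  have h1 := hS M
  have h2 := hM M₀
  linarith
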